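/- Let $d\ge 1$ be an integer and $0<\alpha<1/3$. A complex on $\{1,\dots,n\}$ is a family $X$ of nonempty subsets (simplices) closed under taking nonempty subsets; a simplex with $j+1$ elements is $j$-dimensional. Two $j$-simplices $\sigma,\sigma'$ of $X$ are neighbours if $\sigma\cup\sigma'$ is a $(j+1)$-simplex of $X$, and the 1-neighbourhood of $\sigma$ is the complex $$N_{1,X}(\sigma)=\{\tau\in X:\ \tau\subseteq\sigma'\cup\sigma''\text{ for some }\sigma',\sigma''\text{ each equal to }\sigma\text{ or a neighbour of }\sigma\}.$$ Let $\mathcal C_{d,n}$ be the set of complexes on $\{1,\dots,n\}$ of dimension at most $d$ that contain every nonempty subset with at most $d$ elements. Call $X\in\mathcal C_{d,n}$ exactly reconstructable from its 1-neighbourhoods if every $\widetilde X\in\mathcal C_{d,n}$, such that for each $d$-element set $\sigma\subseteq\{1,\dots,n\}$ the complexes $N_{1,X}(\sigma)$ and $N_{1,\widetilde X}(\sigma)$ are isomorphic (some bijection of the ground sets carries simplices to simplices in both directions), equals $X$. Let $Y_d(n,p_n)$ be the Linial–Meshulam complex, the random element of $\mathcal C_{d,n}$ in which each $(d+1)$-element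 subset is a simplex independently with probability $p_n=n^{-\alpha}$. Then there is $s>0$ such that $$P\big(Y_d(n,p_n)\text{ is not exactly reconstructable from its 1-neighbourhoods}\big)=o(n^{-s})\qquad(n\to\infty).$$ -/

import Mathlib

open Filter Topology MeasureTheory ProbabilityTheory Asymptotics

namespace ShotgunAssembly

/-- Finite abstract simplicial complexes with vertices in `V`, given by their nonempty faces.
Not every element of the ground set `V` has to be a vertex of the complex.
A `j`-dimensional simplex is a face with `j + 1` elements. -/
abbrev Complex (V : Type) := PreAbstractSimplicialComplex V

/-- Two complexes are isomorphic if some bijection of their ground sets preserves faces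
in both directions. -/
def Isomorphic {V W : Type} (X : Complex V) (Y : Complex W) : Prop :=
  ∃ f : V ≃ W, ∀ s : Finset V, s ∈ X ↔ s.map f.toEmbedding ∈ Y

variable {V : Type} [DecidableEq V]

/-- The neighbour relation `σ ∼ σ'` on the simplices of `X`: the two simplices have the same
dimension `j` and their union is a simplex of `X` of dimension `j + 1`. -/
def neighbourGraph (X : Complex V) : SimpleGraph (Finset V) where
  Adj σ σ' := σ ∈ X ∧ σ' ∈ X ∧ σ.card = σ'.card ∧ σ ∪ σ' ∈ X ∧ (σ ∪ σ').card = σ.card + 1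
  symm := ⟨fun σ σ' h => ⟨h.2.1, h.1, h.2.2.1.symm, by
    rw [Finset.union_comm]; exact ⟨h.2.2.2.1, h.2.2.2.2.trans (by rw [h.2.2.1])⟩⟩⟩
  loopless := ⟨fun σ h => by simpa using h.2.2.2.2⟩

/-- The simplices at distance at most `k` from `σ`, where the distance is the least number of
steps of a chain of successive neighbours. -/
def simplexBall (X : Complex V) (k : ℕ) (σ : Finset V) : Set (Finset V) :=
  {σ' | ∃ w : (neighbourGraph X).Walk σ σ', w.length ≤ k}

/-- The `k`-neighbourhood of the simplex `σ` in `X`: the simplices of `X` contained in the union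
of two simplices at distance at most `k` from `σ`. -/
def neighbourhood (X : Complex V) (k : ℕ) (σ : Finset V) : Complex V where
  faces := {τ | τ ∈ X ∧ ∃ σ' ∈ simplexBall X k σ, ∃ σ'' ∈ simplexBall X k σ, τ ⊆ σ' ∪ σ''}
  isRelLowerSet_faces := by
    rintro τ ⟨hτ, σ', h', σ'', h'', hsub⟩
    exact ⟨(X.isRelLowerSet_faces hτ).1, fun ρ hρ hne =>
      ⟨(X.isRelLowerSet_faces hτ).2 hρ hne, σ', h', σ'', h'', hρ.trans hsub⟩⟩

/-- The complexes of dimension at most `d` on the ground set `V` with complete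
`(d - 1)`-dimensional skeleton. -/
def HasCompleteSkeleton (d : ℕ) (X : Complex V) : Prop :=
  (∀ s : Finset V, s.Nonempty → s.card ≤ d → s ∈ X) ∧ ∀ s ∈ X, s.card ≤ d + 1

/-- `X` is exactly reconstructable from its `k`-neighbourhoods: a complex of dimension at most
`d` on the same ground set with complete `(d - 1)`-skeleton equals `X` as soon as, for each
`(d - 1)`-simplex `σ`, the `k`-neighbourhoods of `σ` in the two complexes are isomorphic. -/
def ExactlyReconstructable (d k : ℕ) (X : Complex V) : Prop :=
  ∀ X' : Complex V, HasCompleteSkeleton d X' →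
    (∀ σ : Finset V, σ.card = d → Isomorphic (neighbourhood X k σ) (neighbourhood X' k σ)) →
    X = X'

/-- The complex on `V` with complete `(d - 1)`-dimensional skeleton whose `d`-dimensional
simplices are the sets in `T` with `d + 1` elements. -/
def complexOf (d : ℕ) (T : Set (Finset V)) : Complex V where
  faces := {s | s.Nonempty ∧ (s.card ≤ d ∨ s.card = d + 1 ∧ s ∈ T)}
  isRelLowerSet_faces := by
    rintro s ⟨hs, h⟩
    refine ⟨hs, fun t (hts : t ⊆ s) ht => ⟨ht, ?_⟩⟩
    have hc := Finset.card_le_card hts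
    rcases h with h | ⟨h, hT⟩
    · exact Or.inl (hc.trans h)
    · rcases Nat.lt_or_ge d t.card with h' | h'
      · have : t = s := Finset.eq_of_subset_of_card_le hts (by omega)
        exact Or.inr (this ▸ ⟨h, hT⟩)
      · exact Or.inl h'

/-- The law of the random set of `d`-dimensional simplices of the Linial–Meshulam complex
`Y_d(n, p)` on `n` vertices: each of the sets of `d + 1` vertices is chosen independently with
probability `p`. The random complex `Y_d(n, p)` is `complexOf d T` for `T` with this law. -/
noncomputable def linialMeshulam (d n : ℕ) (p : unitInterval) :
    Measure (Set (Finset (Fin n))) :=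
  setBernoulli {s : Finset (Fin n) | s.card = d + 1} p

end ShotgunAssembly

/-!
The `1`-neighbourhood of a `(d - 1)`-simplex `σ` consists of the simplices with at most two vertices
outside `σ`, all of them in `L(σ)`, the set of vertices that complete `σ` to a `d`-simplex. For
`a ∈ σ` and `b ∈ L(σ)`, with `κ = σ \ {a}`, it therefore shows the link graph of `κ` on the common
neighbours of `a` and `b`: the fingerprint of `(κ, {a, b})`. The same fingerprint is seen from the
facet `κ ∪ {b}`.

Two properties of `X` make it reconstructable (`exactlyReconstructable_of_separating`). If any
`d`-sets `σ₁`, `σ₂` are separated from a third one by many vertices (`Separating`), then an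
isomorphism of neighbourhoods has to carry centre to centre, and fingerprints have many vertices.
If moreover no two moderately large induced subgraphs of link graphs are isomorphic except by
coincidence (`LinksRigid`), then distinct `(κ, {a, b})` have distinct fingerprints
(`SameFingerprint.eq_and_mem`). Now let `X'` have the same neighbourhoods as `X`, and let `f` be
an isomorphism for the centre `σ`. The simplex `σ ∪ {f b}` of `X'` seen from `σ` has the
fingerprint of `(κ, {a, b})`, and seen from its facet containing `f b` and `f κ` it has the
fingerprint of a `d`-simplex of `X` containing that facet. Uniqueness forces `f b = b`. So `f` fixes
`L(σ)` pointwise, and `X = X'`.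

Both properties hold with probability `1 - O(n ^ (-2))`, by union bounds over products of
independent events. Failure of separation by `m` vertices means that, outside some set of
`m + O(d)` vertices, no vertex separates; this has probability at most
`n ^ (m + O(d)) (1 - p² (1 - p)) ^ (n - m - O(d))`. Failure of rigidity means that some two
sequences of `k` vertices induce equal graphs, which for given sequences takes `k (k - 1) / 2`
independent coincidences; it has probability at most
`n ^ (2k + O(d)) (1 - 2p (1 - p)) ^ (k (k - 1) / 2)`. With
`p = n ^ (-α)` these are small if `m log n ≪ n p²` and `log n ≪ k p`, and the first property has
to provide the `m ≥ k` vertices that the second one asks for. Both are possible if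
`n p³ = n ^ (1 - 3 α)` is a positive power of `n`.
-/

namespace ShotgunAssembly

/-! ### The `1`-neighbourhood of a `(d - 1)`-simplex -/

section Deterministic

lemma mem_of_subset {V : Type} {X : Complex V} {s t : Finset V} (hs : s ∈ X) (hts : t ⊆ s)
    (ht : t.Nonempty) : t ∈ X :=
  (X.isRelLowerSet_faces hs).2 hts ht

lemma mem_complexOf {V : Type} {d : ℕ} {T : Set (Finset V)} {s : Finset V} :
    s ∈ complexOf d T ↔ s.Nonempty ∧ (s.card ≤ d ∨ s.card = d + 1 ∧ s ∈ T) :=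
  Iff.rfl

lemma mem_complexOf_of_card {V : Type} {d : ℕ} {T : Set (Finset V)} {s : Finset V}
    (hs : s.card = d + 1) :
    s ∈ complexOf d T ↔ s ∈ T := by
  have : s.Nonempty := Finset.card_pos.1 (by omega)
  simp [mem_complexOf, hs, this]

lemma hasCompleteSkeleton_complexOf {V : Type} (d : ℕ) (T : Set (Finset V)) :
    HasCompleteSkeleton d (complexOf d T) := by
  refine ⟨fun s hs hc => ⟨hs, Or.inl hc⟩, fun s hs => ?_⟩
  rcases hs.2 with h | h <;> omega

variable {V : Type} [DecidableEq V]

lemma self_mem_simplexBall (X : Complex V) (k : ℕ) (σ : Finset V) : σ ∈ simplexBall X k σ :=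
  ⟨.nil, by simp⟩

lemma mem_simplexBall_one {X : Complex V} {σ σ' : Finset V} :
    σ' ∈ simplexBall X 1 σ ↔ σ' = σ ∨ (neighbourGraph X).Adj σ σ' := by
  constructor
  · rintro ⟨w, hw⟩
    cases w with
    | nil => exact Or.inl rfl
    | cons h w' =>
      cases w' with
      | nil => exact Or.inr h
      | cons h' w'' => simp at hw
  · rintro (rfl | h)
    · exact self_mem_simplexBall X 1 σ'
    · exact ⟨h.toWalk, by simp⟩

lemma HasCompleteSkeleton.insert_erase_mem_simplexBall {d : ℕ} {X : Complex V}
    (hX : HasCompleteSkeleton d X) {σ : Finset V} (hσ : σ.card = d) {a v : V} (ha : a ∈ σ)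
    (hv : v ∉ σ) (hvX : insert v σ ∈ X) : insert v (σ.erase a) ∈ simplexBall X 1 σ := by
  have hcard : (insert v (σ.erase a)).card = d := by
    rw [Finset.card_insert_of_notMem (by simp [hv]), Finset.card_erase_of_mem ha]
    have := Finset.card_pos.2 ⟨a, ha⟩
    omega
  have hun : σ ∪ insert v (σ.erase a) = insert v σ := by
    ext x; simp only [Finset.mem_union, Finset.mem_insert, Finset.mem_erase]; tauto
  refine mem_simplexBall_one.2 (Or.inr ⟨hX.1 σ ⟨a, ha⟩ hσ.le,
    hX.1 _ (Finset.insert_nonempty _ _) hcard.le, hσ.trans hcard.symm, ?_, ?_⟩)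
  · rwa [hun]
  · rw [hun, Finset.card_insert_of_notMem hv]

/-- A vertex of the `1`-neighbourhood of `σ` that is not in `σ` spans a simplex with `σ`. -/
lemma insert_mem_of_singleton_mem_neighbourhood {X : Complex V} {σ : Finset V} {x : V}
    (hx : {x} ∈ neighbourhood X 1 σ) (hxσ : x ∉ σ) : insert x σ ∈ X := by
  obtain ⟨-, σ', h', σ'', h'', hsub⟩ := hx
  have key : ∀ ρ ∈ simplexBall X 1 σ, x ∈ ρ → insert x σ ∈ X := by
    intro ρ hρ hxρ
    rcases mem_simplexBall_one.1 hρ with rfl | h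
    · exact absurd hxρ hxσ
    · refine mem_of_subset h.2.2.2.1 ?_ (Finset.insert_nonempty _ _)
      exact Finset.insert_subset (Finset.mem_union_right _ hxρ) Finset.subset_union_left
  rcases Finset.mem_union.1 (hsub (Finset.mem_singleton_self x)) with h | h
  · exact key _ h' h
  · exact key _ h'' h

lemma HasCompleteSkeleton.insert_insert_mem_neighbourhood_iff {d : ℕ} {X : Complex V}
    (hX : HasCompleteSkeleton d X) {σ : Finset V} (hσ : σ.card = d) {a v w : V} (ha : a ∈ σ)
    (hv : v ∉ σ) (hvX : insert v σ ∈ X) (hw : w ∉ σ) (hwX : insert w σ ∈ X) :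
    insert v (insert w (σ.erase a)) ∈ neighbourhood X 1 σ ↔
      insert v (insert w (σ.erase a)) ∈ X := by
  refine ⟨fun h => h.1, fun h => ⟨h, _, hX.insert_erase_mem_simplexBall hσ ha hv hvX, _,
    hX.insert_erase_mem_simplexBall hσ ha hw hwX, ?_⟩⟩
  intro x; simp only [Finset.mem_union, Finset.mem_insert, Finset.mem_erase]; tauto

lemma HasCompleteSkeleton.insert_mem_neighbourhood_iff {d : ℕ} {X : Complex V}
    (hX : HasCompleteSkeleton d X) (hd : 1 ≤ d) {σ : Finset V} (hσ : σ.card = d) {v : V}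
    (hv : v ∉ σ) : insert v σ ∈ neighbourhood X 1 σ ↔ insert v σ ∈ X := by
  obtain ⟨a, ha⟩ := Finset.card_pos.1 (by omega : 0 < σ.card)
  refine ⟨fun h => h.1, fun h => ⟨h, _, self_mem_simplexBall X 1 σ, _,
    hX.insert_erase_mem_simplexBall hσ ha hv h, ?_⟩⟩
  intro x; simp only [Finset.mem_union, Finset.mem_insert, Finset.mem_erase]; tauto

/-! ### Separation, rigidity and fingerprints -/

/-- Any two `d`-sets `σ₁`, `σ₂` are separated from a further `d`-set `σ₃` by at least `m` vertices:
vertices outside the three sets that complete `σ₁` and `σ₂`, but not `σ₃`, to a member of `T`.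
The case `σ₁ = σ₂` is included. -/
def Separating (d m : ℕ) (T : Set (Finset V)) : Prop :=
  ∀ σ₁ σ₂ σ₃ : Finset V, σ₁.card = d → σ₂.card = d → σ₃.card = d → σ₁ ≠ σ₃ → σ₂ ≠ σ₃ →
    ∃ U : Finset V, U.card = m ∧ ∀ w ∈ U, w ∉ σ₁ ∧ w ∉ σ₂ ∧ w ∉ σ₃ ∧
      insert w σ₁ ∈ T ∧ insert w σ₂ ∈ T ∧ insert w σ₃ ∉ T

/-- No two induced subgraphs on `k` vertices of the link graphs of `(d - 1)`-sets `κ`, `κ'` are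
matched by a bijection `s i ↦ t i`, apart from coincidences: the first vertex set has to avoid
`κ'`, and if `κ = κ'` the two vertex sets have to be disjoint. In the link graph of `κ` the
vertices `v` and `w` are adjacent if `κ ∪ {v, w}` is in `T`. -/
def LinksRigid (d k : ℕ) (T : Set (Finset V)) : Prop :=
  ∀ κ κ' : Finset V, κ.card + 1 = d → κ'.card + 1 = d → ∀ s t : Fin k → V,
    Function.Injective s → Function.Injective t → (∀ i, s i ∉ κ) → (∀ i, s i ∉ κ') →
    (∀ i, t i ∉ κ') → (κ = κ' → ∀ i j, s i ≠ t j) →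
    ∃ i j, i < j ∧
      ¬ (insert (s i) (insert (s j) κ) ∈ T ↔ insert (t i) (insert (t j) κ') ∈ T)

/-- The common neighbours of `a` and `b` in the link graph of `κ`. -/
def commonLink (X : Complex V) (κ : Finset V) (a b : V) : Set V :=
  {w | w ∉ κ ∧ w ≠ a ∧ w ≠ b ∧ insert w (insert a κ) ∈ X ∧ insert w (insert b κ) ∈ X}

/-- The fingerprint of `(κ, {a, b})` in `X` is the graph induced by the link graph of `κ` on the
common neighbours of `a` and `b`, up to isomorphism. This says that two fingerprints agree; the
isomorphism is encoded as a permutation of the ground set. -/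
def SameFingerprint (X : Complex V) (κ : Finset V) (a b : V) (X' : Complex V) (κ' : Finset V)
    (a' b' : V) : Prop :=
  ∃ f : V ≃ V, (∀ w, w ∈ commonLink X κ a b ↔ f w ∈ commonLink X' κ' a' b') ∧
    ∀ v ∈ commonLink X κ a b, ∀ w ∈ commonLink X κ a b, v ≠ w →
      (insert v (insert w κ) ∈ X ↔ insert (f v) (insert (f w) κ') ∈ X')

lemma SameFingerprint.trans_symm {X X' X'' : Complex V} {κ κ' κ'' : Finset V}
    {a b a' b' a'' b'' : V}
    (h : SameFingerprint X κ a b X' κ' a' b') (h' : SameFingerprint X'' κ'' a'' b'' X' κ' a' b') :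
    SameFingerprint X κ a b X'' κ'' a'' b'' := by
  obtain ⟨f, hf, hf'⟩ := h
  obtain ⟨g, hg, hg'⟩ := h'
  have hW : ∀ w, w ∈ commonLink X κ a b ↔ (f.trans g.symm) w ∈ commonLink X'' κ'' a'' b'' := by
    intro w
    rw [hf, hg]; simp
  refine ⟨f.trans g.symm, hW, fun v hv w hw hvw => ?_⟩
  rw [hf' v hv w hw hvw, hg' _ ((hW v).1 hv) _ ((hW w).1 hw) (by simpa using hvw)]
  simp

lemma map_insert_insert_erase (f : V ≃ V) (σ : Finset V) (v w a : V) :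
    (insert v (insert w (σ.erase a))).map f.toEmbedding =
      insert (f v) (insert (f w) ((σ.map f.toEmbedding).erase (f a))) := by
  simp only [Finset.map_insert, Finset.map_erase, Equiv.coe_toEmbedding]

/-- An isomorphism of `1`-neighbourhoods of `σ` and `σ'` carrying `σ` to `σ'` preserves the
`d`-simplices containing the centre. -/
lemma insert_mem_iff_of_iso {d : ℕ} (hd : 1 ≤ d) {X X' : Complex V} (hX : HasCompleteSkeleton d X)
    (hX' : HasCompleteSkeleton d X') {σ σ' : Finset V} (hσ : σ.card = d) (f : V ≃ V)
    (hf : ∀ s : Finset V, s ∈ neighbourhood X 1 σ ↔ s.map f.toEmbedding ∈ neighbourhood X' 1 σ')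
    (hfσ : σ.map f.toEmbedding = σ') {v : V} (hv : v ∉ σ) :
    insert v σ ∈ X ↔ insert (f v) σ' ∈ X' := by
  have hσ' : σ'.card = d := by rw [← hfσ, Finset.card_map, hσ]
  have hv' : f v ∉ σ' := by rw [← hfσ]; simpa using hv
  rw [← hX.insert_mem_neighbourhood_iff hd hσ hv, hf, Finset.map_insert, hfσ,
    ← hX'.insert_mem_neighbourhood_iff hd hσ' hv']
  rfl

/-- An isomorphism of `1`-neighbourhoods of `σ` and `σ'` carrying `σ` to `σ'` preserves the
fingerprints of the `d`-simplices `σ ∪ {b}`, where `a` is a vertex of `σ` and `κ = σ \ {a}`. -/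
lemma sameFingerprint_of_iso {d : ℕ} (hd : 1 ≤ d) {X X' : Complex V} (hX : HasCompleteSkeleton d X)
    (hX' : HasCompleteSkeleton d X') {σ σ' : Finset V} (hσ : σ.card = d) (f : V ≃ V)
    (hf : ∀ s : Finset V, s ∈ neighbourhood X 1 σ ↔ s.map f.toEmbedding ∈ neighbourhood X' 1 σ')
    (hfσ : σ.map f.toEmbedding = σ') {a b : V} (ha : a ∈ σ) (hb : b ∉ σ) (hbX : insert b σ ∈ X) :
    SameFingerprint X (σ.erase a) a b X' (σ'.erase (f a)) (f a) (f b) := by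
  have hσ' : σ'.card = d := by rw [← hfσ, Finset.card_map, hσ]
  have hmem : ∀ {v}, v ∈ σ ↔ f v ∈ σ' := by intro v; rw [← hfσ]; simp
  have hL : ∀ {v}, v ∉ σ → (insert v σ ∈ X ↔ insert (f v) σ' ∈ X') := fun hv =>
    insert_mem_iff_of_iso hd hX hX' hσ f hf hfσ hv
  have h2 : ∀ {v w}, v ∉ σ → w ∉ σ → insert v σ ∈ X → insert w σ ∈ X →
      (insert v (insert w (σ.erase a)) ∈ X ↔
        insert (f v) (insert (f w) (σ'.erase (f a))) ∈ X') := by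
    intro v w hv hw hvX hwX
    rw [← hX.insert_insert_mem_neighbourhood_iff hσ ha hv hvX hw hwX, hf,
      map_insert_insert_erase, hfσ,
      hX'.insert_insert_mem_neighbourhood_iff hσ' (hmem.1 ha) (mt hmem.2 hv) ((hL hv).1 hvX)
        (mt hmem.2 hw) ((hL hw).1 hwX)]
  have hout : ∀ {w}, w ∈ commonLink X (σ.erase a) a b → w ∉ σ ∧ insert w σ ∈ X := by
    rintro w ⟨h1, h3, -, h4, -⟩
    rw [Finset.insert_erase ha] at h4
    exact ⟨fun h => h1 (Finset.mem_erase.2 ⟨h3, h⟩), h4⟩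
  refine ⟨f, fun w => ?_, fun v hv w hw _ =>
    h2 (hout hv).1 (hout hw).1 (hout hv).2 (hout hw).2⟩
  simp only [commonLink, Set.mem_ofPred_eq, Finset.insert_erase ha,
    Finset.insert_erase (hmem.1 ha), Finset.mem_erase, ne_eq, f.injective.eq_iff, ← hmem]
  constructor
  · rintro ⟨h1, h3, h4, h5, h6⟩
    have hw : w ∉ σ := fun h => h1 ⟨h3, h⟩
    exact ⟨h1, h3, h4, (hL hw).1 h5, (h2 hw hb h5 hbX).1 h6⟩
  · rintro ⟨h1, h3, h4, h5, h6⟩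
    have hw : w ∉ σ := fun h => h1 ⟨h3, h⟩
    exact ⟨h1, h3, h4, (hL hw).2 h5, (h2 hw hb ((hL hw).2 h5) hbX).2 h6⟩

lemma exists_card_eq_ne_and_ne [Fintype V] {d : ℕ} (hd : 1 ≤ d) (hV : 2 * d < Fintype.card V)
    {σ₁ σ₂ : Finset V} (h₁ : σ₁.card = d) (h₂ : σ₂.card = d) :
    ∃ σ₃ : Finset V, σ₃.card = d ∧ σ₁ ≠ σ₃ ∧ σ₂ ≠ σ₃ := by
  have hlt : (σ₁ ∪ σ₂).card < (Finset.univ : Finset V).card := by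
    rw [Finset.card_univ]
    have := Finset.card_union_le σ₁ σ₂
    omega
  obtain ⟨b, -, hb⟩ := Finset.exists_mem_notMem_of_card_lt_card hlt
  obtain ⟨σ₃, h3, -, h4⟩ := Finset.exists_subsuperset_card_eq (Finset.subset_univ {b})
    (n := d) (by simpa using hd) (by rw [Finset.card_univ]; omega)
  have hb3 : b ∈ σ₃ := h3 (by simp)
  rw [Finset.mem_union, not_or] at hb
  exact ⟨σ₃, h4, fun h => hb.1 (h ▸ hb3), fun h => hb.2 (h ▸ hb3)⟩

/-- In a separating complex with rigid links a fingerprint determines `κ` and `{a, b}`. -/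
lemma SameFingerprint.eq_and_mem [Fintype V] {d k m : ℕ} (hd : 1 ≤ d)
    (hV : 2 * d < Fintype.card V) (hm : k + d ≤ m) {X : Complex V}
    (hsep : Separating d m (X : Set (Finset V))) (hrig : LinksRigid d k (X : Set (Finset V)))
    {κ κ' : Finset V} {a b a' b' : V} (hκ : κ.card + 1 = d) (hκ' : κ'.card + 1 = d)
    (ha : a ∉ κ) (hb : b ∉ κ) (ha' : a' ∉ κ') (hb' : b' ∉ κ')
    (h : SameFingerprint X κ a b X κ' a' b') :
    κ = κ' ∧ (a' = a ∨ a' = b) ∧ (b' = a ∨ b' = b) := by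
  obtain ⟨f, hf, hf'⟩ := h
  have hca : (insert a κ).card = d := by rw [Finset.card_insert_of_notMem ha, hκ]
  have hcb : (insert b κ).card = d := by rw [Finset.card_insert_of_notMem hb, hκ]
  -- A large set of common neighbours on which `f` has no coincidences contradicts rigidity.
  have key : ∀ S : Finset V, k ≤ S.card → (∀ w ∈ S, w ∈ commonLink X κ a b ∧ w ∉ κ') →
      (κ = κ' → ∀ v ∈ S, ∀ w ∈ S, v ≠ f w) → False := by
    intro S hS hSW hdis
    obtain ⟨S', hS', hS'k⟩ := Finset.exists_subset_card_eq hS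
    let e := S'.equivFinOfCardEq hS'k
    have hs : ∀ i, ((e.symm i : S') : V) ∈ S := fun i => hS' (e.symm i).2
    have hinj : Function.Injective (fun i => ((e.symm i : S') : V)) :=
      Subtype.val_injective.comp e.symm.injective
    obtain ⟨i, j, hij, hne⟩ := hrig κ κ' hκ hκ' (fun i => ((e.symm i : S') : V))
      (fun i => f (e.symm i : S')) hinj (f.injective.comp hinj) (fun i => (hSW _ (hs i)).1.1)
      (fun i => (hSW _ (hs i)).2) (fun i => ((hf _).1 (hSW _ (hs i)).1).1)
      (fun h i j => hdis h _ (hs i) _ (hs j))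
    exact hne (hf' _ (hSW _ (hs i)).1 _ (hSW _ (hs j)).1 (fun h => hij.ne (hinj h)))
  -- If `κ ≠ κ'`, removing `κ'` from the common neighbours suffices.
  have hκκ : κ = κ' := by
    by_contra hne
    obtain ⟨σ₃, h3, h31, h32⟩ := exists_card_eq_ne_and_ne hd hV hca hcb
    obtain ⟨U, hU, hUw⟩ := hsep _ _ σ₃ hca hcb h3 h31 h32
    refine key (U \ κ') ?_ ?_ (fun h => absurd h hne)
    · have := Finset.le_card_sdiff κ' U
      omega
    · intro w hw
      obtain ⟨hwU, hw'⟩ := Finset.mem_sdiff.1 hw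
      obtain ⟨h1, h2, -, h4, h5, -⟩ := hUw w hwU
      simp only [Finset.mem_insert, not_or] at h1 h2
      exact ⟨⟨h1.2, h1.1, h2.1, h4, h5⟩, hw'⟩
  subst hκκ
  have hins : ∀ {x y : V}, y ∉ κ → x ≠ y → insert x κ ≠ insert y κ := by
    intro x y hy hxy h
    have : y ∈ insert x κ := h ▸ Finset.mem_insert_self y κ
    rcases Finset.mem_insert.1 this with h | h
    · exact hxy h.symm
    · exact hy h
  -- A vertex `c ∈ {a', b'} \ {a, b}` is adjacent to the whole image of `f`, but not to the many
  -- common neighbours of `a` and `b` that separate them from `c`.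
  have key2 : ∀ c, c ∉ κ → (∀ w ∈ commonLink X κ a' b', insert w (insert c κ) ∈ X) →
      c = a ∨ c = b := by
    intro c hc hcW
    by_contra! hcon
    obtain ⟨U, hU, hUw⟩ := hsep _ _ (insert c κ) hca hcb
      (by rw [Finset.card_insert_of_notMem hc, hκ]) (hins hc hcon.1.symm) (hins hc hcon.2.symm)
    have hUW : ∀ w ∈ U, w ∈ commonLink X κ a b ∧ w ∉ κ := by
      intro w hw
      obtain ⟨h1, h2, -, h4, h5, -⟩ := hUw w hw
      simp only [Finset.mem_insert, not_or] at h1 h2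
      exact ⟨⟨h1.2, h1.1, h2.1, h4, h5⟩, h1.2⟩
    refine key U (by omega) hUW (fun _ v hv w hw hvw => ?_)
    exact (hUw v hv).2.2.2.2.2 (hvw ▸ hcW _ ((hf w).1 (hUW w hw).1))
  exact ⟨rfl, key2 a' ha' fun w hw => hw.2.2.2.1, key2 b' hb' fun w hw => hw.2.2.2.2⟩

/-! ### Reconstruction -/

/-- In a separating complex an isomorphism of `1`-neighbourhoods carries centre to centre. -/
lemma Separating.map_centre {d m : ℕ} (hd : 1 ≤ d) (hm : 1 ≤ m)
    {X X' : Complex V} (hX : HasCompleteSkeleton d X)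
    (hX' : HasCompleteSkeleton d X') (hsep : Separating d m (X : Set (Finset V)))
    {σ : Finset V} (hσ : σ.card = d) (f : V ≃ V)
    (hf : ∀ s : Finset V, s ∈ neighbourhood X 1 σ ↔ s.map f.toEmbedding ∈ neighbourhood X' 1 σ) :
    σ.map f.toEmbedding = σ := by
  -- The preimage `ρ` of the centre spans a simplex with every further vertex of the neighbourhood.
  set ρ := σ.map f.symm.toEmbedding with hρ
  have hρσ : ρ.map f.toEmbedding = σ := by ext x; simp [hρ]
  suffices σ = ρ by rw [this]; exact hρσ.trans this
  by_contra hne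
  obtain ⟨U, hU, hUw⟩ := hsep σ σ ρ hσ hσ (by rw [hρ, Finset.card_map, hσ]) hne hne
  obtain ⟨w, hw⟩ := Finset.card_pos.1 (by omega : 0 < U.card)
  obtain ⟨hwσ, -, hwρ, hwX, -, hnX⟩ := hUw w hw
  have hfw : f w ∉ σ := by rw [← hρσ]; simpa using hwρ
  have h1 : {w} ∈ neighbourhood X 1 σ :=
    mem_of_subset ((hX.insert_mem_neighbourhood_iff hd hσ hwσ).2 hwX) (by simp) (by simp)
  rw [hf, Finset.map_singleton] at h1
  have h2 : insert (f w) σ ∈ X' := insert_mem_of_singleton_mem_neighbourhood h1 hfw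
  rw [← hX'.insert_mem_neighbourhood_iff hd hσ hfw] at h2
  have h3 : insert w ρ ∈ neighbourhood X 1 σ := by
    rw [hf, Finset.map_insert, hρσ]; exact h2
  exact hnX h3.1

/-- A separating complex with complete skeleton and rigid links is exactly reconstructable. -/
theorem exactlyReconstructable_of_separating [Fintype V] {d k m : ℕ} (hd : 1 ≤ d)
    (hV : 2 * d < Fintype.card V) (hm : k + d ≤ m) {X : Complex V} (hX : HasCompleteSkeleton d X)
    (hsep : Separating d m (X : Set (Finset V))) (hrig : LinksRigid d k (X : Set (Finset V))) :
    ExactlyReconstructable d 1 X := by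
  intro X' hX' hiso
  have hm1 : 1 ≤ m := by omega
  have hiff : ∀ σ : Finset V, σ.card = d → ∀ v, v ∉ σ → (insert v σ ∈ X ↔ insert v σ ∈ X') := by
    intro σ hσ
    obtain ⟨f, hf⟩ := hiso σ hσ
    have hfσ := hsep.map_centre hd hm1 hX hX' hσ f hf
    have hmem : ∀ {v}, v ∈ σ ↔ f v ∈ σ := by
      intro v; conv_rhs => rw [← hfσ]
      simp
    have hL : ∀ {v}, v ∉ σ → (insert v σ ∈ X ↔ insert (f v) σ ∈ X') := fun hv =>
      insert_mem_iff_of_iso hd hX hX' hσ f hf hfσ hv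
    -- `f` fixes every `b` completing `σ` to a simplex of `X`.
    have hfix : ∀ b, b ∉ σ → insert b σ ∈ X → f b = b := by
      intro b hb hbX
      obtain ⟨a, ha⟩ := Finset.card_pos.1 (by omega : 0 < σ.card)
      have ha' : f a ∈ σ := hmem.1 ha
      have hb' : f b ∉ σ := mt hmem.2 hb
      have hfp := sameFingerprint_of_iso hd hX hX' hσ f hf hfσ ha hb hbX
      have hκ : ∀ {x}, x ∈ σ → (σ.erase x).card + 1 = d := fun hx => by
        rw [Finset.card_erase_add_one hx, hσ]
      -- The same simplex of `X'` seen from its facet `σ'` containing `f b`.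
      set σ' := insert (f b) (σ.erase (f a)) with hσ'
      have hσ'c : σ'.card = d := by
        rw [hσ', Finset.card_insert_of_notMem (by simp [hb']), hκ ha']
      obtain ⟨g, hg⟩ := hiso σ' hσ'c
      have hgσ := hsep.map_centre hd hm1 hX hX' hσ'c g hg
      have hgmem : ∀ {v}, v ∈ σ' ↔ g v ∈ σ' := by
        intro v; conv_rhs => rw [← hgσ]
        simp
      obtain ⟨b₂, hb₂⟩ : ∃ x, g x = f b := ⟨g.symm (f b), by simp⟩
      obtain ⟨a₂, ha₂⟩ : ∃ x, g x = f a := ⟨g.symm (f a), by simp⟩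
      have hb₂σ : b₂ ∈ σ' := hgmem.2 (by rw [hb₂, hσ']; simp)
      have hab : f a ≠ f b := fun h => hb' (h ▸ ha')
      have ha₂σ : a₂ ∉ σ' := by
        rw [hgmem, ha₂, hσ']; simp [hab]
      have ha₂X : insert a₂ σ' ∈ X := by
        rw [insert_mem_iff_of_iso hd hX hX' hσ'c g hg hgσ ha₂σ, ha₂, hσ', Finset.insert_comm,
          Finset.insert_erase ha', ← hL hb]
        exact hbX
      have hfp' := sameFingerprint_of_iso hd hX hX' hσ'c g hg hgσ hb₂σ ha₂σ ha₂X
      have her : σ'.erase (f b) = σ.erase (f a) := by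
        rw [hσ', Finset.erase_insert (by simp [hb'])]
      rw [hb₂, ha₂, her] at hfp'
      have hfp'' : SameFingerprint X (σ'.erase b₂) a₂ b₂ X' (σ.erase (f a)) (f a) (f b) := by
        obtain ⟨e, he, he'⟩ := hfp'
        have hc : ∀ (Y : Complex V) (κ : Finset V) (x y : V),
            commonLink Y κ x y = commonLink Y κ y x := by
          intro Y κ x y; ext w; simp only [commonLink, Set.mem_ofPred_eq]; tauto
        refine ⟨e, fun w => ?_, ?_⟩
        · rw [hc, hc X']; exact he w
        · rw [hc]; exact he'
      obtain ⟨h1, h2, h3⟩ := SameFingerprint.eq_and_mem hd hV hm hsep hrig (hκ ha)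
        (by rw [Finset.card_erase_add_one hb₂σ, hσ'c]) (Finset.notMem_erase _ _)
        (fun h => hb (Finset.mem_of_mem_erase h)) (fun h => ha₂σ (Finset.mem_of_mem_erase h))
        (Finset.notMem_erase _ _) (hfp.trans_symm hfp'')
      have hfbσ' : f b ∈ σ' := by rw [hσ']; simp
      rcases h3 with rfl | rfl
      · -- `b₂ = a` would give `σ' = σ`, but `f b` is only in the former.
        exact absurd (by
          rw [← Finset.insert_erase ha, h1, Finset.insert_erase hb₂σ]; exact hfbσ') hb'
      · -- Now `σ' = κ ∪ {b}`, so `b ∈ σ' ⊆ σ ∪ {f b}`.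
        rw [hσ', Finset.mem_insert] at hb₂σ
        rcases hb₂σ with h | h
        · exact h.symm
        · exact absurd (Finset.mem_of_mem_erase h) hb
    intro v hv
    refine ⟨fun h => ?_, fun h => ?_⟩
    · have := (hL hv).1 h
      rwa [hfix v hv h] at this
    · -- `v = f u` for some `u`, and `f` fixes `u`.
      obtain ⟨u, rfl⟩ := f.surjective v
      have hu : u ∉ σ := mt hmem.1 hv
      have huX := (hL hu).2 h
      rwa [hfix u hu huX]
  refine SetLike.ext fun s => ?_
  by_cases hs : s.Nonempty
  · rcases lt_trichotomy s.card (d + 1) with h | h | h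
    · exact iff_of_true (hX.1 s hs (by omega)) (hX'.1 s hs (by omega))
    · obtain ⟨v, hv⟩ := hs
      have := hiff (s.erase v) (by rw [Finset.card_erase_of_mem hv]; omega) v
        (Finset.notMem_erase _ _)
      rwa [Finset.insert_erase hv] at this
    · exact iff_of_false (fun h' => absurd (hX.2 s h') (by omega))
        (fun h' => absurd (hX'.2 s h') (by omega))
  · exact iff_of_false (fun h => hs (X.isRelLowerSet_faces h).1)
      (fun h => hs (X'.isRelLowerSet_faces h).1)

lemma Separating.complexOf {d m : ℕ} {T : Set (Finset V)} (h : Separating d m T) :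
    Separating d m (complexOf d T : Set (Finset V)) := by
  intro σ₁ σ₂ σ₃ h₁ h₂ h₃ h13 h23
  obtain ⟨U, hU, hUw⟩ := h σ₁ σ₂ σ₃ h₁ h₂ h₃ h13 h23
  refine ⟨U, hU, fun w hw => ?_⟩
  obtain ⟨w1, w2, w3, hw⟩ := hUw w hw
  refine ⟨w1, w2, w3, ?_⟩
  simp only [SetLike.mem_coe]
  rwa [mem_complexOf_of_card (by rw [Finset.card_insert_of_notMem w1, h₁]),
    mem_complexOf_of_card (by rw [Finset.card_insert_of_notMem w2, h₂]),
    mem_complexOf_of_card (by rw [Finset.card_insert_of_notMem w3, h₃])]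

lemma LinksRigid.complexOf {d k : ℕ} {T : Set (Finset V)} (h : LinksRigid d k T) :
    LinksRigid d k (complexOf d T : Set (Finset V)) := by
  intro κ κ' hκ hκ' s t hs ht hsκ hsκ' htκ' hst
  obtain ⟨i, j, hij, hne⟩ := h κ κ' hκ hκ' s t hs ht hsκ hsκ' htκ' hst
  refine ⟨i, j, hij, ?_⟩
  simp only [SetLike.mem_coe]
  have hsij : s i ≠ s j := fun e => hij.ne (hs e)
  have htij : t i ≠ t j := fun e => hij.ne (ht e)
  rwa [mem_complexOf_of_card (by
      rw [Finset.card_insert_of_notMem (by simp [hsij, hsκ]),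
        Finset.card_insert_of_notMem (hsκ j), hκ]),
    mem_complexOf_of_card (by
      rw [Finset.card_insert_of_notMem (by simp [htij, htκ']),
        Finset.card_insert_of_notMem (htκ' j), hκ'])]

end Deterministic

/-! ### Independent events for random subsets -/

section Probability

variable {ι : Type*}

/-- A set of subsets of `ι` is determined by the elements of `B` if membership in it depends only
on the intersection with `B`. -/
def DeterminedBy (E : Set (Set ι)) (B : Finset ι) : Prop :=
  ∀ T T' : Set ι, (∀ x ∈ B, (x ∈ T ↔ x ∈ T')) → T ∈ E → T' ∈ E

lemma DeterminedBy.eq_preimage {E : Set (Set ι)} {B : Finset ι} (h : DeterminedBy E B) :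
    E = (fun (T : Set ι) (x : B) => (x : ι) ∈ T) ⁻¹'
      ((fun (T : Set ι) (x : B) => (x : ι) ∈ T) '' E) := by
  refine (Set.subset_preimage_image _ _).antisymm ?_
  rintro T ⟨T', hT', he⟩
  exact h T' T (fun x hx => iff_of_eq (congrFun he ⟨x, hx⟩)) hT'

/-- The probability that a `p`-random subset of `u` contains `A` and avoids `B`. -/
lemma setBernoulli_real_cylinder {u : Set ι} {p : unitInterval} {A B : Finset ι} (hA : ↑A ⊆ u)
    (hB : ↑B ⊆ u) (hAB : Disjoint A B) :
    (setBernoulli u p).real {T | (∀ x ∈ A, x ∈ T) ∧ ∀ x ∈ B, x ∉ T} =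
      (p : ℝ) ^ A.card * (1 - p : ℝ) ^ B.card := by
  classical
  have h1 : (fun P : ι → Prop => {i | P i}) ⁻¹'
      {T : Set ι | (∀ x ∈ A, x ∈ T) ∧ ∀ x ∈ B, x ∉ T} =
      Set.pi ↑(A ∪ B) fun i => {P : Prop | P ↔ i ∈ A} := by
    ext P
    simp only [Set.mem_preimage, Set.mem_ofPred_eq, Set.mem_pi, Finset.mem_coe, Finset.mem_union]
    constructor
    · rintro ⟨h1, h2⟩ i (hi | hi)
      · exact iff_of_true (h1 i hi) hi
      · exact iff_of_false (h2 i hi) (Finset.disjoint_right.1 hAB hi)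
    · intro h
      exact ⟨fun x hx => (h x (Or.inl hx)).2 hx,
        fun x hx hxT => Finset.disjoint_right.1 hAB hx ((h x (Or.inr hx)).1 hxT)⟩
  have hpA : ∀ i ∈ A, ((unitInterval.toNNReal p • Measure.dirac (i ∈ u) +
      unitInterval.toNNReal (unitInterval.symm p) • Measure.dirac False : Measure Prop)
        {P : Prop | P ↔ i ∈ A}).toReal = p := by
    intro i hi
    simp [hi, hA (Finset.mem_coe.2 hi)]
  have hpB : ∀ i ∈ B, ((unitInterval.toNNReal p • Measure.dirac (i ∈ u) +
      unitInterval.toNNReal (unitInterval.symm p) • Measure.dirac False : Measure Prop)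
        {P : Prop | P ↔ i ∈ A}).toReal = 1 - p := by
    intro i hi
    simp [Finset.disjoint_right.1 hAB hi, hB (Finset.mem_coe.2 hi)]
  rw [measureReal_def, setBernoulli_apply', h1, Measure.infinitePi_pi _ (fun _ _ => .of_discrete),
    ENNReal.toReal_prod, Finset.prod_union hAB, Finset.prod_congr rfl hpA,
    Finset.prod_congr rfl hpB, Finset.prod_const, Finset.prod_const]

lemma setBernoulli_real_mem_iff_mem_le {u : Set ι} {p : unitInterval} {x y : ι} (hx : x ∈ u)
    (hy : y ∈ u) (hxy : x ≠ y) :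
    (setBernoulli u p).real {T | x ∈ T ↔ y ∈ T} ≤ 1 - 2 * p * (1 - p) := by
  classical
  have h1 := setBernoulli_real_cylinder (p := p) (A := {x, y}) (B := ∅) (u := u)
    (by simp [Set.insert_subset_iff, hx, hy]) (by simp) (by simp)
  have h2 := setBernoulli_real_cylinder (p := p) (A := ∅) (B := {x, y}) (u := u) (by simp)
    (by simp [Set.insert_subset_iff, hx, hy]) (by simp)
  rw [Finset.card_pair hxy] at h1 h2
  have h3 : {T : Set ι | x ∈ T ↔ y ∈ T} ⊆
      {T | (∀ z ∈ ({x, y} : Finset ι), z ∈ T) ∧ ∀ z ∈ (∅ : Finset ι), z ∉ T} ∪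
      {T | (∀ z ∈ (∅ : Finset ι), z ∈ T) ∧ ∀ z ∈ ({x, y} : Finset ι), z ∉ T} := by
    intro T hT
    simp only [Set.mem_ofPred_eq] at hT
    by_cases h : x ∈ T
    · left; simp [h, hT.1 h]
    · right; simp [h, mt hT.2 h]
  calc _ ≤ _ := measureReal_mono h3
    _ ≤ _ := measureReal_union_le _ _
    _ = _ := by rw [h1, h2]; simp; ring

variable [Finite ι]

lemma iIndepFun_mem_setBernoulli (u : Set ι) (p : unitInterval) :
    iIndepFun (fun (i : ι) (T : Set ι) => i ∈ T) (setBernoulli u p) := by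
  have hm : ∀ i : ι, Measurable (fun T : Set ι => i ∈ T) := fun i => .of_discrete
  have hm' : Measurable (fun (T : Set ι) (i : ι) => i ∈ T) := measurable_pi_lambda _ hm
  have hs : Measurable (fun P : ι → Prop => {i | P i}) := .of_discrete
  have key : (setBernoulli u p).map (fun (T : Set ι) (i : ι) => i ∈ T) =
      Measure.infinitePi fun i : ι ↦ unitInterval.toNNReal p • Measure.dirac (i ∈ u) +
        unitInterval.toNNReal (unitInterval.symm p) • Measure.dirac False := by
    rw [setBernoulli_eq_map, Measure.map_map hm' hs]
    exact Measure.map_id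
  rw [iIndepFun_iff_map_fun_eq_infinitePi_map hm, key]
  congr 1
  funext i
  rw [← Measure.infinitePi_map_eval (fun i : ι ↦ unitInterval.toNNReal p • Measure.dirac (i ∈ u) +
        unitInterval.toNNReal (unitInterval.symm p) • Measure.dirac False) i, ← key,
    Measure.map_map (measurable_pi_apply i) hm']
  rfl

/-- Events determined by pairwise disjoint sets of coordinates are independent; only the resulting
upper bound is recorded. -/
lemma setBernoulli_real_forall_le (u : Set ι) (p : unitInterval) {J : Type*} (I : Finset J)
    (E : J → Set (Set ι)) (B : J → Finset ι) {q : ℝ}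
    (hE : ∀ i ∈ I, DeterminedBy (E i) (B i))
    (hB : ∀ i ∈ I, ∀ j ∈ I, i ≠ j → Disjoint (B i) (B j))
    (hq : ∀ i ∈ I, (setBernoulli u p).real (E i) ≤ q) :
    (setBernoulli u p).real {T | ∀ i ∈ I, T ∈ E i} ≤ q ^ I.card := by
  classical
  induction I using Finset.induction_on with
  | empty => simp
  | insert a I ha ih =>
    have ih' := ih (fun i hi => hE i (Finset.mem_insert_of_mem hi))
      (fun i hi j hj => hB i (Finset.mem_insert_of_mem hi) j (Finset.mem_insert_of_mem hj))
      (fun i hi => hq i (Finset.mem_insert_of_mem hi))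
    have hdet : DeterminedBy {T | ∀ i ∈ I, T ∈ E i} (I.biUnion B) := fun T T' h hT i hi =>
      hE i (Finset.mem_insert_of_mem hi) T T'
        (fun x hx => h x (Finset.mem_biUnion.2 ⟨i, hi, hx⟩)) (hT i hi)
    have hdisj : Disjoint (B a) (I.biUnion B) := by
      rw [Finset.disjoint_biUnion_right]
      exact fun i hi => hB a (Finset.mem_insert_self _ _) i (Finset.mem_insert_of_mem hi)
        (fun h => ha (h ▸ hi))
    have hind := (iIndepFun_mem_setBernoulli u p).indepFun_finset (B a) (I.biUnion B) hdisj
      (fun i => .of_discrete)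
    have hset : {T : Set ι | ∀ i ∈ insert a I, T ∈ E i} = E a ∩ {T | ∀ i ∈ I, T ∈ E i} := by
      ext T; simp
    rw [hset, Finset.card_insert_of_notMem ha, pow_succ',
      (hE a (Finset.mem_insert_self _ _)).eq_preimage,
      hdet.eq_preimage, measureReal_def, hind.measure_inter_preimage_eq_mul _ _ .of_discrete
        .of_discrete, ENNReal.toReal_mul, ← (hE a (Finset.mem_insert_self _ _)).eq_preimage,
      ← hdet.eq_preimage]
    exact mul_le_mul (hq a (Finset.mem_insert_self _ _)) ih' measureReal_nonneg
      (measureReal_nonneg.trans (hq a (Finset.mem_insert_self _ _)))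

lemma measureReal_le_card_mul {Ω : Type*} [MeasurableSpace Ω] (μ : Measure Ω)
    [IsFiniteMeasure μ] {J : Type*} (I : Finset J) (E : J → Set Ω) {S : Set Ω} {q : ℝ}
    (hS : ∀ ω ∈ S, ∃ i ∈ I, ω ∈ E i) (hq : ∀ i ∈ I, μ.real (E i) ≤ q) :
    μ.real S ≤ I.card * q := by
  calc μ.real S ≤ μ.real (⋃ i ∈ I, E i) :=
        measureReal_mono (fun ω hω => by simpa using hS ω hω) (measure_ne_top _ _)
    _ ≤ ∑ i ∈ I, μ.real (E i) := measureReal_biUnion_finset_le _ _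
    _ ≤ I.card * q := by
        rw [← nsmul_eq_mul]; exact Finset.sum_le_card_nsmul _ _ _ hq

lemma setBernoulli_real_not_and_le {u : Set ι} {p : unitInterval} {x y z : ι} (hx : x ∈ u)
    (hy : y ∈ u) (hz : z ∈ u) (hxz : x ≠ z) (hyz : y ≠ z) :
    (setBernoulli u p).real {T | ¬ (x ∈ T ∧ y ∈ T ∧ z ∉ T)} ≤ 1 - p ^ 2 * (1 - p) := by
  classical
  have h1 := setBernoulli_real_cylinder (p := p) (A := {x, y}) (B := {z}) (u := u)
    (by simp [Set.insert_subset_iff, hx, hy]) (by simp [hz]) (by simp [hxz.symm, hyz.symm])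
  have h2 : {T : Set ι | ¬ (x ∈ T ∧ y ∈ T ∧ z ∉ T)} =
      {T | (∀ a ∈ ({x, y} : Finset ι), a ∈ T) ∧ ∀ a ∈ ({z} : Finset ι), a ∉ T}ᶜ := by
    ext T; simp [and_assoc]
  rw [h2, probReal_compl_eq_one_sub .of_discrete, h1, Finset.card_singleton, pow_one]
  -- `x = y` is allowed, and only increases the probability.
  have h3 : (p : ℝ) ^ 2 ≤ (p : ℝ) ^ ({x, y} : Finset ι).card :=
    pow_le_pow_of_le_one p.2.1 p.2.2 Finset.card_le_two
  have := mul_le_mul_of_nonneg_right h3 (sub_nonneg.2 p.2.2)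
  linarith

end Probability

/-! ### Union bounds in the Linial–Meshulam complex -/

section Bounds

variable {d n : ℕ} {p : unitInterval}

instance : IsProbabilityMeasure (linialMeshulam d n p) :=
  inferInstanceAs (IsProbabilityMeasure (setBernoulli _ _))

lemma linialMeshulam_real_not_separating_le {m : ℕ} (hm : m ≤ n) :
    (linialMeshulam d n p).real {T | ¬ Separating d m T} ≤
      (n : ℝ) ^ (3 * d + m) * (1 - (p : ℝ) ^ 2 * (1 - p)) ^ (n - (3 * d + m)) := by
  classical
  have hq0 : (0 : ℝ) ≤ 1 - (p : ℝ) ^ 2 * (1 - p) := by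
    have := mul_le_one₀ (pow_le_one₀ (n := 2) p.2.1 p.2.2) (sub_nonneg.2 p.2.2)
      (sub_le_self 1 p.2.1)
    linarith
  have hq1 : 1 - (p : ℝ) ^ 2 * (1 - p) ≤ 1 := by
    have := mul_nonneg (pow_nonneg p.2.1 2) (sub_nonneg.2 p.2.2)
    linarith
  let P := Finset.powersetCard d (Finset.univ : Finset (Fin n))
  let Q := Finset.powersetCard m (Finset.univ : Finset (Fin n))
  let I := (P ×ˢ P ×ˢ P ×ˢ Q).filter fun x => x.1 ≠ x.2.2.1 ∧ x.2.1 ≠ x.2.2.1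
  let R : Finset (Fin n) × Finset (Fin n) × Finset (Fin n) × Finset (Fin n) → Finset (Fin n) :=
    fun x => (x.1 ∪ x.2.1 ∪ x.2.2.1 ∪ x.2.2.2)ᶜ
  -- If `σ₁`, `σ₂` are not separated from `σ₃`, some `m`-set contains all separating vertices.
  have hcover : ∀ T ∈ {T : Set (Finset (Fin n)) | ¬ Separating d m T}, ∃ x ∈ I,
      T ∈ {T | ∀ w ∈ R x, T ∈ {T | ¬ (insert w x.1 ∈ T ∧ insert w x.2.1 ∈ T ∧
        insert w x.2.2.1 ∉ T)}} := by
    intro T hT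
    simp only [Separating, Set.mem_ofPred_eq, not_forall] at hT
    obtain ⟨σ₁, σ₂, σ₃, h₁, h₂, h₃, h13, h23, hU⟩ := hT
    let G := Finset.univ.filter fun w => w ∉ σ₁ ∧ w ∉ σ₂ ∧ w ∉ σ₃ ∧
      insert w σ₁ ∈ T ∧ insert w σ₂ ∈ T ∧ insert w σ₃ ∉ T
    have hG : G.card ≤ m := by
      by_contra! hlt
      obtain ⟨U, hUG, hUm⟩ := Finset.exists_subset_card_eq hlt.le
      exact hU ⟨U, hUm, fun w hw => (Finset.mem_filter.1 (hUG hw)).2⟩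
    obtain ⟨M, hGM, -, hM⟩ := Finset.exists_subsuperset_card_eq (Finset.subset_univ G) hG
      (by simpa using hm)
    refine ⟨(σ₁, σ₂, σ₃, M), ?_, ?_⟩
    · simp [I, P, Q, Finset.mem_powersetCard, h₁, h₂, h₃, h13, h23, hM]
    · intro w hw hcon
      simp only [R, Finset.mem_compl, Finset.mem_union, not_or] at hw
      exact hw.2 (hGM (by simp only [G, Finset.mem_filter, Finset.mem_univ, true_and]; tauto))
  have hbound : ∀ x ∈ I, (linialMeshulam d n p).real
      {T | ∀ w ∈ R x, T ∈ {T | ¬ (insert w x.1 ∈ T ∧ insert w x.2.1 ∈ T ∧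
        insert w x.2.2.1 ∉ T)}} ≤ (1 - (p : ℝ) ^ 2 * (1 - p)) ^ (n - (3 * d + m)) := by
    rintro ⟨σ₁, σ₂, σ₃, M⟩ hx
    simp only [I, P, Q, Finset.mem_filter, Finset.mem_product, Finset.mem_powersetCard_univ] at hx
    obtain ⟨⟨h₁, h₂, h₃, hM⟩, h13, h23⟩ := hx
    have hR : ∀ w ∈ R (σ₁, σ₂, σ₃, M), w ∉ σ₁ ∧ w ∉ σ₂ ∧ w ∉ σ₃ := by
      intro w hw
      simp only [R, Finset.mem_compl, Finset.mem_union, not_or] at hw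
      tauto
    have hins : ∀ {w : Fin n} {σ σ' : Finset (Fin n)}, w ∉ σ → w ∉ σ' → σ ≠ σ' →
        insert w σ ≠ insert w σ' := by
      intro w σ σ' h h' hne he
      exact hne (by rw [← Finset.erase_insert h, he, Finset.erase_insert h'])
    refine (setBernoulli_real_forall_le (q := 1 - (p : ℝ) ^ 2 * (1 - p)) _ p
      (R (σ₁, σ₂, σ₃, M)) _ (fun w => {insert w σ₁, insert w σ₂, insert w σ₃}) ?_ ?_ ?_).trans ?_
    · intro w _ T T' h hT
      simp only [Finset.mem_insert, Finset.mem_singleton, forall_eq_or_imp, forall_eq] at h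
      simpa only [Set.mem_ofPred_eq, h.1, h.2.1, h.2.2] using hT
    · intro v hv w hw hvw
      have hv' := hR v hv
      -- Every set in the block of `w` contains `w`, and none in the block of `v` does.
      rw [Finset.disjoint_left]
      have hvb : ∀ s ∈ ({insert v σ₁, insert v σ₂, insert v σ₃} : Finset (Finset (Fin n))),
          w ∉ s := by
        have hw' := hR w hw
        simp [hw', hvw.symm]
      have hwb : ∀ s ∈ ({insert w σ₁, insert w σ₂, insert w σ₃} : Finset (Finset (Fin n))),
          w ∈ s := by simp
      exact fun s hs hs' => hvb s hs (hwb s hs')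
    · intro w hw
      obtain ⟨w1, w2, w3⟩ := hR w hw
      exact setBernoulli_real_not_and_le (by simp [w1, h₁]) (by simp [w2, h₂]) (by simp [w3, h₃])
        (hins w1 w3 h13) (hins w2 w3 h23)
    · refine pow_le_pow_of_le_one hq0 hq1 ?_
      have hc : (σ₁ ∪ σ₂ ∪ σ₃ ∪ M).card ≤ 3 * d + m := by
        have e1 := Finset.card_union_le (σ₁ ∪ σ₂ ∪ σ₃) M
        have e2 := Finset.card_union_le (σ₁ ∪ σ₂) σ₃
        have e3 := Finset.card_union_le σ₁ σ₂
        omega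
      simp only [R, Finset.card_compl, Fintype.card_fin]
      omega
  refine (measureReal_le_card_mul _ I _ hcover hbound).trans ?_
  refine mul_le_mul_of_nonneg_right ?_ (pow_nonneg hq0 _)
  have hI : I.card ≤ n ^ (3 * d + m) := by
    calc I.card ≤ (P ×ˢ P ×ˢ P ×ˢ Q).card := Finset.card_filter_le _ _
      _ = n.choose d * (n.choose d * (n.choose d * n.choose m)) := by simp [P, Q]
      _ ≤ n ^ d * (n ^ d * (n ^ d * n ^ m)) := by
          gcongr <;> exact Nat.choose_le_pow _ _
      _ = n ^ (3 * d + m) := by ring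
  exact_mod_cast hI

lemma linialMeshulam_real_not_linksRigid_le {k : ℕ} (hd : 1 ≤ d) (hn : 1 ≤ n) :
    (linialMeshulam d n p).real {T | ¬ LinksRigid d k T} ≤
      (n : ℝ) ^ (2 * d + 2 * k) * (1 - 2 * (p : ℝ) * (1 - p)) ^ (k * (k - 1) / 2) := by
  classical
  have hq0 : (0 : ℝ) ≤ 1 - 2 * (p : ℝ) * (1 - p) := by nlinarith [sq_nonneg (1 - 2 * (p : ℝ))]
  let P := Finset.powersetCard (d - 1) (Finset.univ : Finset (Fin n))
  let Q := (Finset.univ : Finset (Fin k → Fin n))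
  let I := (P ×ˢ P ×ˢ Q ×ˢ Q).filter fun x => Function.Injective x.2.2.1 ∧
    Function.Injective x.2.2.2 ∧ (∀ i, x.2.2.1 i ∉ x.1) ∧ (∀ i, x.2.2.1 i ∉ x.2.1) ∧
    (∀ i, x.2.2.2 i ∉ x.2.1) ∧ (x.1 = x.2.1 → ∀ i j, x.2.2.1 i ≠ x.2.2.2 j)
  let J : Finset (Σ _ : Fin k, Fin k) := Finset.univ.sigma fun j => Finset.Iio j
  have hJ : J.card = k * (k - 1) / 2 := by
    rw [Finset.card_sigma]
    simp only [Fin.card_Iio]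
    rw [Fin.sum_univ_eq_sum_range (fun i => i), Finset.sum_range_id]
  -- For fixed `κ`, `κ'`, `s`, `t` the pairs `(j, i)` in `J` give independent coincidences.
  have hcover : ∀ T ∈ {T : Set (Finset (Fin n)) | ¬ LinksRigid d k T}, ∃ x ∈ I,
      T ∈ {T | ∀ e ∈ J, T ∈ {T | insert (x.2.2.1 e.2) (insert (x.2.2.1 e.1) x.1) ∈ T ↔
        insert (x.2.2.2 e.2) (insert (x.2.2.2 e.1) x.2.1) ∈ T}} := by
    intro T hT
    simp only [LinksRigid, Set.mem_ofPred_eq, not_forall] at hT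
    obtain ⟨κ, κ', hκ, hκ', s, t, hs, ht, hsκ, hsκ', htκ', hst, hne⟩ := hT
    refine ⟨(κ, κ', s, t), ?_, ?_⟩
    · simp only [I, P, Q, Finset.mem_filter, Finset.mem_product, Finset.mem_powersetCard_univ,
        Finset.mem_univ, and_true]
      exact ⟨⟨by omega, by omega⟩, hs, ht, hsκ, hsκ', htκ', fun h i j => hst h i j⟩
    · rintro ⟨j, i⟩ he
      simp only [J, Finset.mem_sigma, Finset.mem_univ, Finset.mem_Iio, true_and] at he
      by_contra hcon
      exact hne ⟨i, j, he, hcon⟩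
  have hbound : ∀ x ∈ I, (linialMeshulam d n p).real
      {T | ∀ e ∈ J, T ∈ {T | insert (x.2.2.1 e.2) (insert (x.2.2.1 e.1) x.1) ∈ T ↔
        insert (x.2.2.2 e.2) (insert (x.2.2.2 e.1) x.2.1) ∈ T}} ≤
      (1 - 2 * (p : ℝ) * (1 - p)) ^ (k * (k - 1) / 2) := by
    rintro ⟨κ, κ', s, t⟩ hx
    simp only [I, P, Q, Finset.mem_filter, Finset.mem_product, Finset.mem_powersetCard_univ,
        Finset.mem_univ, and_true] at hx
    obtain ⟨⟨hκ, hκ'⟩, hs, ht, hsκ, hsκ', htκ', hst⟩ := hx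
    -- The sets `κ ∪ {s i, s j}` and `κ' ∪ {t i, t j}` are all distinct.
    have hpair : ∀ (κ : Finset (Fin n)) (s : Fin k → Fin n), Function.Injective s →
        (∀ i, s i ∉ κ) → ∀ i j i' j' : Fin k, i < j → i' < j' →
        insert (s i) (insert (s j) κ) = insert (s i') (insert (s j') κ) → i = i' ∧ j = j' := by
      intro κ s hs hsκ i j i' j' hij hij' he
      have h1 : s i ∈ insert (s i') (insert (s j') κ) := he ▸ by simp
      have h2 : s j ∈ insert (s i') (insert (s j') κ) := he ▸ by simp
      simp only [Finset.mem_insert, hsκ, hs.eq_iff, or_false] at h1 h2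
      omega
    have hcross : ∀ i j i' j' : Fin k, i < j →
        insert (s i) (insert (s j) κ) ≠ insert (t i') (insert (t j') κ') := by
      intro i j i' j' hij he
      have h1 : s i ∈ insert (t i') (insert (t j') κ') := he ▸ by simp
      have h2 : s j ∈ insert (t i') (insert (t j') κ') := he ▸ by simp
      simp only [Finset.mem_insert, hsκ', or_false] at h1 h2
      have hne : s i ≠ s j := fun h => hij.ne (hs h)
      have hκκ : κ = κ' := by
        have h3 : insert (s i) (insert (s j) κ) = insert (s i) (insert (s j) κ') := by
          rw [he]
          rcases h1 with h1 | h1 <;> rcases h2 with h2 | h2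
          · exact absurd (h1.trans h2.symm) hne
          · rw [h1, h2]
          · rw [h1, h2, Finset.insert_comm]
          · exact absurd (h1.trans h2.symm) hne
        rw [← Finset.erase_insert (hsκ j), ← Finset.erase_insert (hsκ' j),
          ← Finset.erase_insert (s := insert (s j) κ) (a := s i) (by simp [hne, hsκ]), h3,
          Finset.erase_insert (by simp [hne, hsκ'])]
      rcases h1 with h1 | h1
      · exact hst hκκ _ _ h1
      · exact hst hκκ _ _ h1
    have hcard : ∀ (κ : Finset (Fin n)) (s : Fin k → Fin n), κ.card = d - 1 →
        Function.Injective s → (∀ i, s i ∉ κ) → ∀ i j : Fin k, i < j →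
        (insert (s i) (insert (s j) κ)).card = d + 1 := by
      intro κ s hκ hs hsκ i j hij
      have hne : s i ≠ s j := fun h => hij.ne (hs h)
      rw [Finset.card_insert_of_notMem (by simp [hne, hsκ]), Finset.card_insert_of_notMem (hsκ j)]
      omega
    have hJlt : ∀ e ∈ J, e.2 < e.1 := fun e he => by simpa [J] using he
    rw [← hJ]
    refine setBernoulli_real_forall_le _ p J _
      (fun e => {insert (s e.2) (insert (s e.1) κ), insert (t e.2) (insert (t e.1) κ')}) ?_ ?_ ?_
    · intro e _ T T' h hT
      simp only [Finset.mem_insert, Finset.mem_singleton, forall_eq_or_imp, forall_eq] at h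
      simpa only [Set.mem_ofPred_eq, h.1, h.2] using hT
    · rintro ⟨j, i⟩ he ⟨j', i'⟩ he' hee
      have hij := hJlt _ he
      have hij' := hJlt _ he'
      have hneq : ¬ (i = i' ∧ j = j') := by
        rintro ⟨rfl, rfl⟩; exact hee rfl
      simp only [Finset.disjoint_insert_left, Finset.disjoint_singleton_left, Finset.mem_insert,
        Finset.mem_singleton, not_or]
      exact ⟨⟨fun h => hneq (hpair κ s hs hsκ _ _ _ _ hij hij' h), hcross _ _ _ _ hij⟩,
        fun h => hcross _ _ _ _ hij' h.symm,
        fun h => hneq (hpair κ' t ht htκ' _ _ _ _ hij hij' h)⟩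
    · intro e he
      have hij := hJlt e he
      exact setBernoulli_real_mem_iff_mem_le (hcard κ s hκ hs hsκ _ _ hij)
        (hcard κ' t hκ' ht htκ' _ _ hij) (hcross _ _ _ _ hij)
  refine (measureReal_le_card_mul _ I _ hcover hbound).trans ?_
  refine mul_le_mul_of_nonneg_right ?_ (pow_nonneg hq0 _)
  have hI : I.card ≤ n ^ (2 * d + 2 * k) := by
    calc I.card ≤ (P ×ˢ P ×ˢ Q ×ˢ Q).card := Finset.card_filter_le _ _
      _ = n.choose (d - 1) * (n.choose (d - 1) * (n ^ k * n ^ k)) := by simp [P, Q]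
      _ ≤ n ^ (d - 1) * (n ^ (d - 1) * (n ^ k * n ^ k)) := by
          gcongr <;> exact Nat.choose_le_pow _ _
      _ = n ^ (2 * (d - 1) + 2 * k) := by ring
      _ ≤ n ^ (2 * d + 2 * k) := Nat.pow_le_pow_right hn (by omega)
  exact_mod_cast hI

end Bounds

/-! ### Asymptotics -/

section Asymptotics

lemma not_exactlyReconstructable_le {d n k : ℕ} {p : unitInterval} (hd : 1 ≤ d) (hn : 2 * d < n)
    (hk : k + d ≤ n) :
    (linialMeshulam d n p).real {T | ExactlyReconstructable d 1 (complexOf d T)}ᶜ ≤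
      (n : ℝ) ^ (4 * d + k) * (1 - (p : ℝ) ^ 2 * (1 - p)) ^ (n - (4 * d + k)) +
      (n : ℝ) ^ (2 * d + 2 * k) * (1 - 2 * (p : ℝ) * (1 - p)) ^ (k * (k - 1) / 2) := by
  have hsub : {T | ExactlyReconstructable d 1 (complexOf d T)}ᶜ ⊆
      {T : Set (Finset (Fin n)) | ¬ Separating d (k + d) T} ∪ {T | ¬ LinksRigid d k T} := by
    intro T hT
    by_contra hcon
    simp only [Set.mem_union, Set.mem_ofPred_eq, not_or, not_not] at hcon
    exact hT (exactlyReconstructable_of_separating hd (by simpa using hn) le_rfl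
      (hasCompleteSkeleton_complexOf d T) hcon.1.complexOf hcon.2.complexOf)
  refine (measureReal_mono hsub (measure_ne_top _ _)).trans ((measureReal_union_le _ _).trans ?_)
  have h1 := linialMeshulam_real_not_separating_le (d := d) (p := p) hk
  have h2 := linialMeshulam_real_not_linksRigid_le (k := k) (p := p) hd (by omega : 1 ≤ n)
  rw [show 3 * d + (k + d) = 4 * d + k by ring] at h1
  exact add_le_add h1 h2

lemma pow_mul_pow_le {N q r : ℝ} {a b : ℕ} (hN : 0 < N) (hq : 0 ≤ q) (hqr : q ≤ Real.exp (-r))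
    (h : a * Real.log N + 2 * Real.log N ≤ r * b) : N ^ a * q ^ b ≤ N ^ (-2 : ℝ) := by
  have h1 : N ^ a = Real.exp (a * Real.log N) := by
    rw [← Real.log_pow, Real.exp_log (pow_pos hN a)]
  have h2 : q ^ b ≤ Real.exp (-(r * b)) := by
    calc q ^ b ≤ Real.exp (-r) ^ b := pow_le_pow_left₀ hq hqr b
      _ = _ := by rw [← Real.exp_nat_mul]; ring_nf
  calc N ^ a * q ^ b ≤ Real.exp (a * Real.log N) * Real.exp (-(r * b)) := by
        rw [h1]; exact mul_le_mul_of_nonneg_left h2 (Real.exp_nonneg _)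
    _ = Real.exp (a * Real.log N - r * b) := by rw [← Real.exp_add, sub_eq_add_neg]
    _ ≤ Real.exp (Real.log N * (-2)) := Real.exp_le_exp.2 (by linarith)
    _ = N ^ (-2 : ℝ) := by rw [Real.rpow_def_of_pos hN]

lemma one_sub_sq_mul_le_exp {q : ℝ} (hq2 : q ≤ 1 / 2) :
    1 - q ^ 2 * (1 - q) ≤ Real.exp (-(q ^ 2 / 2)) := by
  have h1 := Real.add_one_le_exp (-(q ^ 2 / 2))
  have h2 := mul_nonneg (sq_nonneg q) (by linarith : 0 ≤ 1 / 2 - q)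
  linarith

lemma one_sub_two_mul_le_exp {q : ℝ} (hq0 : 0 ≤ q) (hq2 : q ≤ 1 / 2) :
    1 - 2 * q * (1 - q) ≤ Real.exp (-q) := by
  have h1 := Real.add_one_le_exp (-q)
  have h2 := mul_nonneg hq0 (by linarith : 0 ≤ 1 - 2 * q)
  linarith

lemma sq_div_four_le_cast {x : ℝ} {k : ℕ} (hx : 2 ≤ x) (hk : x ≤ k) :
    x ^ 2 / 4 ≤ ((k * (k - 1) / 2 : ℕ) : ℝ) := by
  have hk1 : 1 ≤ k := by
    have : (1 : ℝ) ≤ k := by linarith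
    exact_mod_cast this
  rw [Nat.cast_div (Nat.even_mul_pred_self k).two_dvd (by norm_num)]
  push_cast [Nat.cast_sub hk1]
  have := mul_le_mul hk (by linarith : x / 2 ≤ k - 1) (by linarith) (by linarith)
  linarith

lemma eventually_not_exactlyReconstructable_le {d : ℕ} (hd : 1 ≤ d) {α : ℝ} (hα₀ : 0 < α)
    (hα₁ : α < 1 / 3) {p : ℕ → unitInterval}
    (hp : ∀ n : ℕ, 1 ≤ n → (p n : ℝ) = (n : ℝ) ^ (-α)) :
    ∀ᶠ n : ℕ in atTop, (linialMeshulam d n (p n)).real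
      {T | ExactlyReconstructable d 1 (complexOf d T)}ᶜ ≤ 2 * (n : ℝ) ^ (-2 : ℝ) := by
  -- With `k ≈ n ^ β` both exponents gained are of order `n ^ (β + δ)`, and those lost of order
  -- `n ^ β log n`; here `δ > 0` is where `α < 1 / 3` enters.
  set β : ℝ := (1 - α) / 2 with hβ
  set δ : ℝ := (1 - 3 * α) / 2 with hδ
  have hβ0 : 0 < β := by rw [hβ]; linarith
  have hδ0 : 0 < δ := by rw [hδ]; linarith
  have hT : Tendsto (fun n : ℕ => (n : ℝ)) atTop atTop := tendsto_natCast_atTop_atTop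
  have e1 : ∀ᶠ n : ℕ in atTop, 4 * (d : ℝ) + 6 ≤ (n : ℝ) ^ β :=
    ((tendsto_rpow_atTop hβ0).comp hT).eventually_ge_atTop _
  have e2 : ∀ᶠ n : ℕ in atTop, (2 : ℝ) ≤ (n : ℝ) ^ α :=
    ((tendsto_rpow_atTop hα₀).comp hT).eventually_ge_atTop _
  have e3 : ∀ᶠ n : ℕ in atTop, (8 : ℝ) ≤ (n : ℝ) ^ (1 - β) :=
    ((tendsto_rpow_atTop (by rw [hβ]; linarith : 0 < 1 - β)).comp hT).eventually_ge_atTop _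
  have e4 : ∀ᶠ n : ℕ in atTop, ‖Real.log (n : ℝ)‖ ≤ 1 / 32 * ‖(n : ℝ) ^ δ‖ :=
    hT.eventually ((isLittleO_log_rpow_atTop hδ0).bound (by norm_num))
  filter_upwards [e1, e2, e3, e4, eventually_ge_atTop 1] with n h1 h2 h3 h4 hn
  have hn1 : (1 : ℝ) ≤ n := by exact_mod_cast hn
  have hn0 : (0 : ℝ) < n := by linarith
  have hlog0 : 0 ≤ Real.log n := Real.log_nonneg hn1
  rw [Real.norm_of_nonneg hlog0, Real.norm_of_nonneg (Real.rpow_nonneg hn0.le _)] at h4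
  set x : ℝ := (n : ℝ) ^ β with hx
  have hx0 : 0 < x := by linarith
  set k : ℕ := ⌈x⌉₊ with hk
  have hk1 : x ≤ k := Nat.le_ceil x
  have hk2 : (k : ℝ) ≤ x + 1 := (Nat.ceil_lt_add_one hx0.le).le
  have hxn : 8 * x ≤ n := by
    calc 8 * x ≤ (n : ℝ) ^ (1 - β) * (n : ℝ) ^ β := mul_le_mul_of_nonneg_right h3 hx0.le
      _ = n := by rw [← Real.rpow_add hn0]; simp
  have hkd : 4 * d + k ≤ n := by
    have : (4 * d + k : ℝ) ≤ n := by linarith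
    exact_mod_cast this
  set q : ℝ := (p n : ℝ) with hq
  have hqα : q = (n : ℝ) ^ (-α) := hp n hn
  have hq0 : 0 ≤ q := (p n).2.1
  have hq2 : q ≤ 1 / 2 := by
    rw [hqα, Real.rpow_neg hn0.le, ← one_div]
    exact one_div_le_one_div_of_le two_pos h2
  -- Both gains are bounded below by `8 x log n`.
  have hgain : 8 * (x * Real.log n) ≤ x * (n : ℝ) ^ δ / 4 := by
    linarith [mul_le_mul_of_nonneg_left h4 hx0.le]
  have hsq : q ^ 2 * n = x * (n : ℝ) ^ δ := by
    rw [hqα, hx, ← Real.rpow_natCast, ← Real.rpow_mul hn0.le, ← Real.rpow_add hn0]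
    nth_rewrite 2 [← Real.rpow_one (n : ℝ)]
    rw [← Real.rpow_add hn0]
    congr 1
    rw [hβ, hδ]; push_cast; ring
  have hqx : q * x ^ 2 = x * (n : ℝ) ^ δ := by
    rw [hqα, hx, ← Real.rpow_natCast, ← Real.rpow_mul hn0.le, ← Real.rpow_add hn0,
      ← Real.rpow_add hn0]
    congr 1
    rw [hβ, hδ]; push_cast; ring
  refine (not_exactlyReconstructable_le (k := k) hd (by omega) (by omega)).trans ?_
  rw [two_mul ((n : ℝ) ^ (-2 : ℝ))]
  have hxlog : 0 ≤ x * Real.log n := mul_nonneg hx0.le hlog0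
  refine add_le_add (pow_mul_pow_le (r := q ^ 2 / 2) hn0 ?_ ?_ ?_)
    (pow_mul_pow_le (r := q) hn0 ?_ ?_ ?_)
  · have := mul_le_one₀ (pow_le_one₀ (n := 2) (p n).2.1 (p n).2.2) (sub_nonneg.2 (p n).2.2)
      (sub_le_self 1 (p n).2.1)
    linarith
  · exact one_sub_sq_mul_le_exp hq2
  · have hb : (n : ℝ) / 2 ≤ ((n - (4 * d + k) : ℕ) : ℝ) := by
      rw [Nat.cast_sub hkd]; push_cast; linarith
    have ha : ((4 * d + k : ℕ) : ℝ) + 2 ≤ 2 * x := by push_cast; linarith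
    have h5 := mul_le_mul_of_nonneg_right ha hlog0
    have h6 := mul_le_mul_of_nonneg_left hb (by positivity : 0 ≤ q ^ 2 / 2)
    linarith
  · have := mul_nonneg hq0 (sub_nonneg.2 hq2)
    linarith [sq_nonneg (1 - 2 * q)]
  · exact one_sub_two_mul_le_exp hq0 hq2
  · have hb := sq_div_four_le_cast (by linarith) hk1
    have ha : ((2 * d + 2 * k : ℕ) : ℝ) + 2 ≤ 4 * x := by push_cast; linarith
    have h5 := mul_le_mul_of_nonneg_right ha hlog0
    have h6 := mul_le_mul_of_nonneg_left hb hq0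
    linarith

end Asymptotics

end ShotgunAssembly

theorem theorem1 (d : ℕ) (hd : 1 ≤ d) (α : ℝ) (hα₀ : 0 < α) (hα₁ : α < 1 / 3)
    (p : ℕ → unitInterval) (hp : ∀ n : ℕ, 1 ≤ n → (p n : ℝ) = (n : ℝ) ^ (-α)) :
    ∃ s : ℝ, 0 < s ∧
      (fun n : ℕ => (ShotgunAssembly.linialMeshulam d n (p n)).real
        {T | ShotgunAssembly.ExactlyReconstructable d 1 (ShotgunAssembly.complexOf d T)}ᶜ)
      =o[atTop] (fun n : ℕ => (n : ℝ) ^ (-s)) := by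
  refine ⟨1, one_pos, ?_⟩
  have hO : (fun n : ℕ => (ShotgunAssembly.linialMeshulam d n (p n)).real
        {T | ShotgunAssembly.ExactlyReconstructable d 1 (ShotgunAssembly.complexOf d T)}ᶜ)
      =O[atTop] (fun n : ℕ => (n : ℝ) ^ (-2 : ℝ)) := by
    refine IsBigO.of_bound 2 ?_
    filter_upwards [ShotgunAssembly.eventually_not_exactlyReconstructable_le hd hα₀ hα₁ hp]
      with n hn
    rwa [Real.norm_of_nonneg measureReal_nonneg,
      Real.norm_of_nonneg (Real.rpow_nonneg n.cast_nonneg _)]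
  refine hO.trans_isLittleO (isLittleO_of_tendsto' ?_ ?_)
  · filter_upwards [eventually_ge_atTop 1] with n hn h
    have hn0 : (0 : ℝ) < n := by exact_mod_cast hn
    exact absurd h (Real.rpow_pos_of_pos hn0 _).ne'
  · refine ((tendsto_rpow_neg_atTop one_pos).comp tendsto_natCast_atTop_atTop).congr' ?_
    filter_upwards [eventually_ge_atTop 1] with n hn
    have hn0 : (0 : ℝ) < n := by exact_mod_cast hn
    rw [Function.comp_apply, ← Real.rpow_sub hn0]
    norm_num
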